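/- Let $0<m<L$ and $\rho\in(0,1)$, and consider a real discrete-time linear system \[ x_{k+1}=A_Gx_k+B_Gu_k,\qquad z_k=C_{G1}x_k+D_{G1}u_k,\qquad v_k=C_{G2}x_k, \] with $x_k\in\mathbb R^n$, $u_k\in\mathbb R^{n_u}$, $z_k\in\mathbb R^d$, $v_k\in\mathbb R^{n_v}$ (where $n_v=0$ is allowed). Put $C_G=\begin{pmatrix}C_{G1}\\ C_{G2}\end{pmatrix}$ and \[ \begin{pmatrix}A&B_1&B\\ C_1&D_1&E\\ C&F&0\end{pmatrix}= \left(\begin{array}{cc|c|c}I_d&0&I_d&0\\ 0&A_G&0&B_G\\ \hline 0&C_{G1}&0&D_{G1}\\ \hline I_d&0&0&0\\ 0&C_{G2}&0&0\end{array}\right). \] The transformed extremum-control plant is the linear system with state $\xi_k\in\mathbb R^{d+n}$, disturbance $\tilde w_k\in\mathbb R^d$, control input $u_k$, controlled output $\tilde z_k\in\mathbb R^d$ and measurement $y_k\in\mathbb R^{d+n_v}$ given by \[ \begin{pmatrix}\xi_{k+1}\\ \tilde z_k\\ y_k\end{pmatrix}= \begin{pmatrix}\rho^{-1}(A+mB_1C_1)&\rho^{-1}B_1&\rho^{-1}(B+mB_1E)\\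 (L-m)C_1&-I_d&(L-m)E\\ C&0&0\end{pmatrix} \begin{pmatrix}\xi_k\\ \tilde w_k\\ u_k\end{pmatrix}. \] A controller with real matrices $(A_c,B_c,C_c,D_c)$ of arbitrary finite state dimension (possibly $0$), mapping $y$ to $u$, stabilizes this plant if, with $\tilde A=\rho^{-1}(A+mB_1C_1)$ and $\tilde B=\rho^{-1}(B+mB_1E)$, all eigenvalues of the closed-loop matrix \[ \begin{pmatrix}\tilde A+\tilde BD_cC&\tilde BC_c\\ B_cC&A_c\end{pmatrix} \] have modulus strictly less than $1$. An eigenvalue $\lambda\in\mathbb C$ of $A_G$ is an uncontrollable mode of $(A_G,B_G)$ if there is a nonzero complex row vector $x$ with $xA_G=\lambda x$ and $xB_G=0$; it is an unobservable mode of $(A_G,C_G)$ if there is a nonzero complex column vector $x$ with $A_Gx=\lambda x$ and $C_Gx=0$. Then there exists a controller which stabilizes the transformed extremum-control plant if and only if the following three conditions all hold: 1. $(A_G,B_G)$ has no uncontrollable mode $\lambda$ with $|\lambda|\ge\rho$; 2. $(A_G,C_G)$ has no unobservable mode $\lambda$ with $|\lambda|\ge\rho$; 3. the matrix $\begin{pmatrix}A_G-I&B_G\\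 C_{G1}&D_{G1}\end{pmatrix}$ has full row rank $n+d$. -/

import Mathlib

namespace ExtremumControl

/-- The complexification of a real matrix. -/
noncomputable abbrev toComplex {ι κ : Type*} (M : Matrix ι κ ℝ) : Matrix ι κ ℂ :=
  M.map (algebraMap ℝ ℂ)

/-- A real square matrix is Schur if all its (complex) eigenvalues have modulus less than one. -/
def IsSchur {ι : Type*} [Fintype ι] [DecidableEq ι] (A : Matrix ι ι ℝ) : Prop :=
  ∀ lam : ℂ, Module.End.HasEigenvalue (Matrix.toLin' (toComplex A)) lam → ‖lam‖ < 1

/-- `lam` is an uncontrollable mode of `(A, B)`: it is an eigenvalue of `A` which has a nonzero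
complex left eigenvector `x` (a row vector) with `x B = 0`. -/
def IsUncontrollableMode {ι κ : Type*} [Fintype ι] [DecidableEq ι]
    (A : Matrix ι ι ℝ) (B : Matrix ι κ ℝ) (lam : ℂ) : Prop :=
  Module.End.HasEigenvalue (Matrix.toLin' (toComplex A)) lam ∧
    ∃ x : ι → ℂ, x ≠ 0 ∧ Matrix.vecMul x (toComplex A) = lam • x ∧
      Matrix.vecMul x (toComplex B) = 0

/-- `lam` is an unobservable mode of `(A, C)`: it is an eigenvalue of `A` which has a nonzero
complex (right) eigenvector `x` with `C x = 0`. -/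
def IsUnobservableMode {ι κ : Type*} [Fintype ι] [DecidableEq ι]
    (A : Matrix ι ι ℝ) (C : Matrix κ ι ℝ) (lam : ℂ) : Prop :=
  Module.End.HasEigenvalue (Matrix.toLin' (toComplex A)) lam ∧
    ∃ x : ι → ℂ, x ≠ 0 ∧ Matrix.mulVec (toComplex A) x = lam • x ∧
      Matrix.mulVec (toComplex C) x = 0

/-- The rank equals the number of rows. -/
def HasFullRowRank {ι κ : Type*} [Fintype ι] [Fintype κ] (M : Matrix ι κ ℝ) : Prop :=
  M.rank = Fintype.card ι

/-- A generalized plant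
`x⁺ = A x + B₁ w + B u`, `z = C₁ x + D₁ w + E u`, `y = C x + F w`,
with signals indexed by `X` (state), `W` (disturbance), `U` (control input),
`Z` (controlled output) and `Y` (measurement). There is no direct feedthrough from `u` to `y`. -/
structure GeneralizedPlant (X W U Z Y : Type*) where
  A : Matrix X X ℝ
  B₁ : Matrix X W ℝ
  B : Matrix X U ℝ
  C₁ : Matrix Z X ℝ
  D₁ : Matrix Z W ℝ
  E : Matrix Z U ℝ
  C : Matrix Y X ℝ
  F : Matrix Y W ℝ

/-- A dynamic linear time-invariant controller `ξ⁺ = A_c ξ + B_c y`, `u = C_c ξ + D_c y`. -/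
structure Controller (S Y U : Type*) where
  A : Matrix S S ℝ
  B : Matrix S Y ℝ
  C : Matrix U S ℝ
  D : Matrix U Y ℝ

/-- The state matrix of the feedback interconnection of plant and controller, for the
state `(x, ξ)`. -/
def closedLoopMatrix {X W U Z Y S : Type*} [Fintype U] [Fintype Y]
    (P : GeneralizedPlant X W U Z Y) (K : Controller S Y U) : Matrix (X ⊕ S) (X ⊕ S) ℝ :=
  Matrix.fromBlocks
    (P.A + P.B * K.D * P.C) (P.B * K.C)
    (K.B * P.C)             K.A

/-- Internal stabilization: the closed-loop state matrix is Schur. -/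
def Stabilizes {X W U Z Y S : Type*} [Fintype X] [DecidableEq X] [Fintype U] [Fintype Y]
    [Fintype S] [DecidableEq S]
    (K : Controller S Y U) (P : GeneralizedPlant X W U Z Y) : Prop :=
  IsSchur (closedLoopMatrix P K)

/-- The given linear system `x⁺ = A x + B u`, `z = C₁ x + D₁ u`, `v = C₂ x` with `n` states,
`nu` inputs, and outputs `z` of dimension `d` and `v` of dimension `nv`. -/
structure System (n nu d nv : ℕ) where
  A : Matrix (Fin n) (Fin n) ℝ
  B : Matrix (Fin n) (Fin nu) ℝ
  C₁ : Matrix (Fin d) (Fin n) ℝ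
  D₁ : Matrix (Fin d) (Fin nu) ℝ
  C₂ : Matrix (Fin nv) (Fin n) ℝ

/-- The full output matrix `col(C₁, C₂)` of the system. -/
def System.C {n nu d nv : ℕ} (G : System n nu d nv) : Matrix (Fin d ⊕ Fin nv) (Fin n) ℝ :=
  Matrix.fromRows G.C₁ G.C₂

/-- The generalized plant for extremum control: the state consists of the state `η` of the
integrator `η⁺ = η + w` and the state `x` of the system driven by `u`; the controlled output is
the first output `z` of the system, and the measurement is `(η, v)`. -/
def extremumPlant {n nu d nv : ℕ} (G : System n nu d nv) :
    GeneralizedPlant (Fin d ⊕ Fin n) (Fin d) (Fin nu) (Fin d) (Fin d ⊕ Fin nv) where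
  A := Matrix.fromBlocks 1 0 0 G.A
  B₁ := Matrix.fromRows 1 0
  B := Matrix.fromRows 0 G.B
  C₁ := Matrix.fromCols 0 G.C₁
  D₁ := 0
  E := G.D₁
  C := Matrix.fromBlocks 1 0 0 G.C₂
  F := 0

/-- The generalized plant obtained from `extremumPlant G` by the loop transformation for the
sector `[m, L]` and the exponential signal weighting with rate `ρ`: with
`w̃ = ρ^{-k} (w - m z)` and `z̃ = ρ^{-k} (L z - w)`. -/
noncomputable def transformedPlant {n nu d nv : ℕ} (G : System n nu d nv) (m L ρ : ℝ) :
    GeneralizedPlant (Fin d ⊕ Fin n) (Fin d) (Fin nu) (Fin d) (Fin d ⊕ Fin nv) :=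
  let P := extremumPlant G
  { A := ρ⁻¹ • (P.A + m • (P.B₁ * P.C₁))
    B₁ := ρ⁻¹ • P.B₁
    B := ρ⁻¹ • (P.B + m • (P.B₁ * P.E))
    C₁ := (L - m) • P.C₁
    D₁ := -1
    E := (L - m) • P.E
    C := P.C
    F := 0 }

end ExtremumControl

namespace ExtremumControl

open Matrix Polynomial

/-! A plant without feedthrough from `u` to `y` is stabilizable by output feedback exactly when it
passes the two Hautus tests (`exists_stabilizes_iff`). Necessity: an eigenvector violating a test,
padded by zero, is an eigenvector of every closed loop. Sufficiency: over ℂ, rank-one feedbacks move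
the bad eigenvalues to 0 one at a time, duality gives the output injection, and an observer combines
both. The resulting complex controller becomes real by carrying a simulated plant copy as the
imaginary part.

For the transformed plant, after clearing `ρ⁻¹`, the tests concern `[1, m C₁; 0, A_G]` and `[m D₁;
B_G]` for `|λ| ≥ ρ`. A left eigenvector `(a, b)` has `(1 - λ) a = 0`. So either `a = 0` and `b`
certifies an uncontrollable mode, or `λ = 1`, which lies in the region because `ρ < 1`, and `(b, m
a)` is in the left kernel of the rank-condition matrix. The measured integrator state supplies `C₁`
in the detectability test. -/

/-- A complex square matrix without eigenvalues outside the open unit disc. -/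
def IsSchurComplex {ι : Type*} [Fintype ι] (A : Matrix ι ι ℂ) : Prop :=
  ∀ lam : ℂ, 1 ≤ ‖lam‖ → ∀ v : ι → ℂ, A *ᵥ v = lam • v → v = 0

/-- The Hautus test for stabilizability of a complex pair `(A, B)`. -/
def IsHautusStabilizable {ι κ : Type*} [Fintype ι] (A : Matrix ι ι ℂ) (B : Matrix ι κ ℂ) : Prop :=
  ∀ lam : ℂ, 1 ≤ ‖lam‖ → ∀ x : ι → ℂ, x ᵥ* A = lam • x → x ᵥ* B = 0 → x = 0

/-- The Hautus test for detectability of a complex pair `(A, C)`. -/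
def IsHautusDetectable {ι κ : Type*} [Fintype ι] (A : Matrix ι ι ℂ) (C : Matrix κ ι ℂ) : Prop :=
  ∀ lam : ℂ, 1 ≤ ‖lam‖ → ∀ x : ι → ℂ, A *ᵥ x = lam • x → C *ᵥ x = 0 → x = 0

/-! ### Eigenvectors, characteristic roots and the Schur property -/

section Eigen

variable {ι : Type*} [Fintype ι] [DecidableEq ι]

theorem sub_scalar_mulVec (A : Matrix ι ι ℂ) (lam : ℂ) (v : ι → ℂ) :
    (scalar ι lam - A) *ᵥ v = 0 ↔ A *ᵥ v = lam • v := by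
  rw [sub_mulVec, sub_eq_zero, scalar_apply, ← smul_one_eq_diagonal, smul_mulVec, one_mulVec]
  exact eq_comm

theorem vecMul_sub_scalar (A : Matrix ι ι ℂ) (lam : ℂ) (v : ι → ℂ) :
    v ᵥ* (scalar ι lam - A) = 0 ↔ v ᵥ* A = lam • v := by
  rw [vecMul_sub, sub_eq_zero, scalar_apply, ← smul_one_eq_diagonal, vecMul_smul, vecMul_one]
  exact eq_comm

theorem exists_right_eigenvector_iff (A : Matrix ι ι ℂ) (lam : ℂ) :
    (∃ v, v ≠ 0 ∧ A *ᵥ v = lam • v) ↔ A.charpoly.eval lam = 0 := by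
  rw [eval_charpoly, ← exists_mulVec_eq_zero_iff]
  simp only [sub_scalar_mulVec]

theorem exists_left_eigenvector_iff (A : Matrix ι ι ℂ) (lam : ℂ) :
    (∃ v, v ≠ 0 ∧ v ᵥ* A = lam • v) ↔ A.charpoly.eval lam = 0 := by
  rw [eval_charpoly, ← exists_vecMul_eq_zero_iff]
  simp only [vecMul_sub_scalar]

theorem hasEigenvalue_toLin'_iff (A : Matrix ι ι ℂ) (lam : ℂ) :
    Module.End.HasEigenvalue (Matrix.toLin' A) lam ↔ ∃ v, v ≠ 0 ∧ A *ᵥ v = lam • v := by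
  constructor
  · intro h
    obtain ⟨v, hv⟩ := h.exists_hasEigenvector
    exact ⟨v, hv.2, by simpa using hv.apply_eq_smul⟩
  · rintro ⟨v, hv, h⟩
    exact Module.End.hasEigenvalue_of_hasEigenvector
      ⟨Module.End.mem_eigenspace_iff.2 (by simpa using h), hv⟩

theorem isSchurComplex_iff_charpoly {A : Matrix ι ι ℂ} :
    IsSchurComplex A ↔ ∀ lam : ℂ, 1 ≤ ‖lam‖ → A.charpoly.eval lam ≠ 0 := by
  refine forall₂_congr fun lam _ => ?_
  rw [Ne, ← exists_right_eigenvector_iff]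
  push Not
  exact forall_congr' fun v => ⟨fun h hv hA => hv (h hA), fun h hA => by_contra fun hv => h hv hA⟩

theorem isSchurComplex_transpose {A : Matrix ι ι ℂ} :
    IsSchurComplex Aᵀ ↔ IsSchurComplex A := by
  rw [isSchurComplex_iff_charpoly, isSchurComplex_iff_charpoly, charpoly_transpose]

theorem IsSchurComplex.left_eigenvector_eq_zero {A : Matrix ι ι ℂ} (hA : IsSchurComplex A)
    {lam : ℂ} (hlam : 1 ≤ ‖lam‖) {x : ι → ℂ} (hx : x ᵥ* A = lam • x) : x = 0 :=
  isSchurComplex_transpose.2 hA lam hlam x (by rw [mulVec_transpose, hx])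

theorem isSchur_iff {A : Matrix ι ι ℝ} : IsSchur A ↔ IsSchurComplex (toComplex A) := by
  refine forall_congr' fun lam => ?_
  rw [hasEigenvalue_toLin'_iff]
  constructor
  · intro h h1 v hv
    by_contra h0
    exact absurd (h ⟨v, h0, hv⟩) (not_lt.2 h1)
  · rintro h ⟨v, h0, hv⟩
    by_contra h1
    exact h0 (h (not_lt.1 h1) v hv)

end Eigen

/-! ### Stabilization by complex state feedback and output injection -/

section StateFeedback

variable {ι κ : Type*} [Fintype ι] [Fintype κ]

/-- A rank-one update along a left eigenvector moves exactly one eigenvalue. -/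
theorem charpoly_add_vecMulVec [DecidableEq ι] (A : Matrix ι ι ℂ) {lam : ℂ} {x : ι → ℂ} (b : ι → ℂ)
    (h0 : x ≠ 0) (hx : x ᵥ* A = lam • x) :
    (X - C lam) * (A + vecMulVec b x).charpoly =
      (X - C (lam + x ⬝ᵥ b)) * A.charpoly := by
  refine Polynomial.funext fun s => ?_
  simp only [eval_mul, eval_sub, eval_X, eval_C]
  by_cases hs : s = lam
  · rw [hs, (exists_left_eigenvector_iff A lam).1 ⟨x, h0, hx⟩]
    simp
  have hs' : s - lam ≠ 0 := sub_ne_zero.2 hs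
  -- Since `x (s - A) = (s - lam) x`, the rank-one term factors through `s - A`, so the determinant
  -- is multiplied by `1 - (x ⬝ᵥ b) / (s - lam)`.
  have hfac : scalar ι s - (A + vecMulVec b x) =
      (1 + vecMulVec (-(s - lam)⁻¹ • b) x) * (scalar ι s - A) := by
    have : x ᵥ* (scalar ι s - A) = (s - lam) • x := by
      rw [vecMul_sub, hx, scalar_apply, ← smul_one_eq_diagonal, vecMul_smul, vecMul_one, sub_smul]
    rw [add_mul, one_mul, vecMulVec_mul, this, vecMulVec_smul, smul_vecMulVec, smul_smul,
      mul_neg, mul_inv_cancel₀ hs', neg_one_smul]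
    abel
  rw [eval_charpoly, eval_charpoly, hfac, det_mul,
    vecMulVec_eq Unit, det_one_add_replicateCol_mul_replicateRow]
  simp only [dotProduct_smul, smul_eq_mul]
  field_simp
  ring

/-- A row vector with `x B = 0` annihilates `B F`, so feedback does not affect the test. -/
theorem IsHautusStabilizable.add_mul {A : Matrix ι ι ℂ} {B : Matrix ι κ ℂ}
    (h : IsHautusStabilizable A B) (F : Matrix κ ι ℂ) : IsHautusStabilizable (A + B * F) B := by
  intro lam hlam x hx hB
  refine h lam hlam x ?_ hB
  rwa [vecMul_add, ← vecMul_vecMul, hB, zero_vecMul, add_zero] at hx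

/-- Stabilizability by complex state feedback. -/
theorem IsHautusStabilizable.exists_feedback [DecidableEq ι] {A : Matrix ι ι ℂ} {B : Matrix ι κ ℂ}
    (h : IsHautusStabilizable A B) : ∃ F : Matrix κ ι ℂ, IsSchurComplex (A + B * F) := by
  classical
  -- Induction on the number of eigenvalues outside the open disc, with multiplicity.
  induction hN : A.charpoly.roots.countP (fun s => 1 ≤ ‖s‖) generalizing A with
  | zero =>
    refine ⟨0, ?_⟩
    rw [Matrix.mul_zero, add_zero, isSchurComplex_iff_charpoly]
    intro lam hlam h0
    exact Multiset.countP_eq_zero.1 hN lam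
      ((mem_roots A.charpoly_monic.ne_zero).2 h0) hlam
  | succ N ih =>
    obtain ⟨lam, hmem, hlam⟩ := Multiset.countP_pos.1 (by rw [hN]; exact N.succ_pos)
    obtain ⟨x, hx0, hx⟩ := (exists_left_eigenvector_iff A lam).2
      ((mem_roots A.charpoly_monic.ne_zero).1 hmem)
    have hxB : x ᵥ* B ≠ 0 := fun h0 => hx0 (h lam hlam x hx h0)
    obtain ⟨j, hj⟩ := Function.ne_iff.1 hxB
    -- Scaled so that `x ⬝ᵥ B u = -lam`: the feedback `u xᵀ` moves `lam` to 0 and keeps the other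
    -- roots.
    let u : κ → ℂ := Pi.single j (-lam / (x ᵥ* B) j)
    have hu : x ⬝ᵥ (B *ᵥ u) = -lam := by
      rw [dotProduct_mulVec, dotProduct_single]
      exact mul_div_cancel₀ _ hj
    have hchar := charpoly_add_vecMulVec A (B *ᵥ u) hx0 hx
    rw [hu, add_neg_cancel] at hchar
    have hroots := congrArg roots hchar
    rw [roots_mul (mul_ne_zero (X_sub_C_ne_zero _) (charpoly_monic _).ne_zero),
      roots_mul (mul_ne_zero (X_sub_C_ne_zero _) (charpoly_monic _).ne_zero),
      roots_X_sub_C, roots_X_sub_C] at hroots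
    have hcount := congrArg (Multiset.countP (fun s : ℂ => 1 ≤ ‖s‖)) hroots
    simp only [Multiset.countP_add, hN] at hcount
    have h1 : Multiset.countP (fun s : ℂ => 1 ≤ ‖s‖) {lam} = 1 := by
      simp [Multiset.countP_eq_card_filter, Multiset.filter_singleton, hlam]
    have h2 : Multiset.countP (fun s : ℂ => 1 ≤ ‖s‖) {0} = 0 := by
      simp [Multiset.countP_eq_card_filter, Multiset.filter_singleton]
    rw [h1, h2] at hcount
    have hmul : vecMulVec (B *ᵥ u) x = B * vecMulVec u x := (mul_vecMulVec _ _ _).symm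
    rw [hmul] at hcount
    obtain ⟨F, hF⟩ := ih (h.add_mul (vecMulVec u x)) (by omega)
    exact ⟨vecMulVec u x + F, by rwa [Matrix.mul_add, ← add_assoc]⟩

/-- Stabilizability of the error dynamics by complex output injection. -/
theorem IsHautusDetectable.exists_injection [DecidableEq ι] {A : Matrix ι ι ℂ} {C : Matrix κ ι ℂ}
    (h : IsHautusDetectable A C) : ∃ L : Matrix ι κ ℂ, IsSchurComplex (A + L * C) := by
  have h' : IsHautusStabilizable Aᵀ Cᵀ := by
    intro lam hlam x hx hC
    rw [vecMul_transpose] at hx hC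
    exact h lam hlam x hx hC
  obtain ⟨F, hF⟩ := h'.exists_feedback
  refine ⟨Fᵀ, isSchurComplex_transpose.1 ?_⟩
  rwa [transpose_add, transpose_mul, transpose_transpose]

end StateFeedback


/-! ### Real matrices acting on complex vectors -/

section Complexification

variable {ι κ μ : Type*}

theorem toComplex_add (M N : Matrix ι κ ℝ) :
    toComplex (M + N) = toComplex M + toComplex N :=
  Matrix.map_add _ (map_add _) M N

theorem toComplex_sub (M N : Matrix ι κ ℝ) :
    toComplex (M - N) = toComplex M - toComplex N :=
  Matrix.map_sub _ (map_sub _) M N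

theorem toComplex_neg (M : Matrix ι κ ℝ) : toComplex (-M) = -toComplex M :=
  Matrix.map_neg _ (map_neg _) M

theorem toComplex_zero : toComplex (0 : Matrix ι κ ℝ) = 0 :=
  Matrix.map_zero _ (map_zero _)

theorem toComplex_one [DecidableEq ι] : toComplex (1 : Matrix ι ι ℝ) = 1 :=
  Matrix.map_one _ (map_zero _) (map_one _)

theorem toComplex_smul (r : ℝ) (M : Matrix ι κ ℝ) :
    toComplex (r • M) = (r : ℂ) • toComplex M := by
  ext i j
  simp [toComplex]

theorem toComplex_mul [Fintype κ] (M : Matrix ι κ ℝ) (N : Matrix κ μ ℝ) :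
    toComplex (M * N) = toComplex M * toComplex N :=
  Matrix.map_mul

theorem toComplex_re_add_im (M : Matrix ι κ ℂ) :
    toComplex (M.map Complex.re) + Complex.I • toComplex (M.map Complex.im) = M := by
  ext i j
  simp [toComplex, mul_comm Complex.I, Complex.re_add_im]

theorem toComplex_fromBlocks {ι' κ' : Type*} (M : Matrix ι κ ℝ) (N : Matrix ι κ' ℝ)
    (O : Matrix ι' κ ℝ) (Q : Matrix ι' κ' ℝ) :
    toComplex (fromBlocks M N O Q) =
      fromBlocks (toComplex M) (toComplex N) (toComplex O) (toComplex Q) :=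
  fromBlocks_map M N O Q _

theorem toComplex_fromRows {ι' : Type*} (M : Matrix ι κ ℝ) (N : Matrix ι' κ ℝ) :
    toComplex (fromRows M N) = fromRows (toComplex M) (toComplex N) := by
  ext (i | i) j <;> rfl

theorem toComplex_fromCols {κ' : Type*} (M : Matrix ι κ ℝ) (N : Matrix ι κ' ℝ) :
    toComplex (fromCols M N) = fromCols (toComplex M) (toComplex N) := by
  ext i (j | j) <;> rfl

theorem smul_sumElim (c : ℂ) (f : ι → ℂ) (g : κ → ℂ) :
    c • Sum.elim f g = Sum.elim (c • f) (c • g) := by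
  ext (i | i) <;> rfl

theorem add_sumElim (f f' : ι → ℂ) (g g' : κ → ℂ) :
    Sum.elim f g + Sum.elim f' g' = Sum.elim (f + f') (g + g') := by
  ext (i | i) <;> rfl

theorem sumElim_eq_iff (f f' : ι → ℂ) (g g' : κ → ℂ) :
    Sum.elim f g = Sum.elim f' g' ↔ f = f' ∧ g = g' :=
  ⟨fun h => ⟨funext fun i => congrFun h (Sum.inl i), funext fun i => congrFun h (Sum.inr i)⟩,
    fun h => by rw [h.1, h.2]⟩

theorem eq_zero_of_add_sub_I_smul {f g : ι → ℂ} (h : f + Complex.I • g = 0)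
    (h' : f - Complex.I • g = 0) : f = 0 ∧ g = 0 := by
  have hf : f = 0 := by
    have : (2 : ℂ) • f = 0 := by rw [two_smul]; simpa using congrArg₂ (· + ·) h h'
    simpa using this
  subst hf
  simpa using h

theorem star_toComplex_mulVec [Fintype κ] (M : Matrix ι κ ℝ) (v : κ → ℂ) :
    star (toComplex M *ᵥ v) = toComplex M *ᵥ star v := by
  ext i
  simp [mulVec, dotProduct, toComplex]

theorem toComplex_vecMul_re [Fintype ι] (M : Matrix ι κ ℝ) (x : ι → ℂ) (j : κ) :
    ((x ᵥ* toComplex M) j).re = ((fun i => (x i).re) ᵥ* M) j := by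
  simp [vecMul, dotProduct, toComplex]

theorem toComplex_vecMul_im [Fintype ι] (M : Matrix ι κ ℝ) (x : ι → ℂ) (j : κ) :
    ((x ᵥ* toComplex M) j).im = ((fun i => (x i).im) ᵥ* M) j := by
  simp [vecMul, dotProduct, toComplex]

/-- A real matrix has full row rank iff its complexification has trivial left kernel. -/
theorem hasFullRowRank_iff [Fintype ι] [Fintype κ] {M : Matrix ι κ ℝ} :
    HasFullRowRank M ↔ ∀ x : ι → ℂ, x ᵥ* toComplex M = 0 → x = 0 := by
  have h1 : HasFullRowRank M ↔ LinearIndependent ℝ M.row := by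
    rw [HasFullRowRank, rank_eq_finrank_span_row, linearIndependent_iff_card_eq_finrank_span]
    exact eq_comm
  rw [h1, ← vecMul_injective_iff]
  constructor
  · intro h x hx
    have key : ∀ y : ι → ℝ, y ᵥ* M = 0 → y = 0 := fun y hy => h (by simpa using hy)
    have hre := key (fun i => (x i).re) (by
      ext j; rw [← toComplex_vecMul_re, hx]; rfl)
    have him := key (fun i => (x i).im) (by
      ext j; rw [← toComplex_vecMul_im, hx]; rfl)
    ext i
    exact Complex.ext (congrFun hre i) (congrFun him i)
  · intro h y y' hy
    have h0 : (y - y') ᵥ* M = 0 := by rw [sub_vecMul, sub_eq_zero]; exact hy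
    have := h (fun i => ((y i - y' i : ℝ) : ℂ)) (by
      ext j
      refine Complex.ext ?_ ?_
      · rw [toComplex_vecMul_re]
        exact congrFun h0 j
      · rw [toComplex_vecMul_im]
        simp [vecMul, dotProduct])
    ext i
    exact sub_eq_zero.1 (Complex.ofReal_eq_zero.1 (congrFun this i))

end Complexification

/-! ### Observer-based controllers and their realification -/

section Controllers

variable {X W U Z Y S : Type*} [Fintype X] [Fintype U] [Fintype Y] [Fintype S]

/-- The complex controller `s⁺ = Ac s + Bc y`, `u = Cc s` stabilizes the real plant `(A, B, C)`. -/
def ComplexStabilizes (A : Matrix X X ℝ) (B : Matrix X U ℝ) (C : Matrix Y X ℝ)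
    (Ac : Matrix S S ℂ) (Bc : Matrix S Y ℂ) (Cc : Matrix U S ℂ) : Prop :=
  ∀ lam : ℂ, 1 ≤ ‖lam‖ → ∀ (z : X → ℂ) (s : S → ℂ),
    toComplex A *ᵥ z + toComplex B *ᵥ (Cc *ᵥ s) = lam • z →
    Bc *ᵥ (toComplex C *ᵥ z) + Ac *ᵥ s = lam • s → z = 0 ∧ s = 0

/-- The complex observer-based controller. -/
theorem complexStabilizes_observer {A : Matrix X X ℝ} {B : Matrix X U ℝ} {C : Matrix Y X ℝ}
    {F : Matrix U X ℂ} {L : Matrix X Y ℂ}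
    (hF : IsSchurComplex (toComplex A + toComplex B * F))
    (hL : IsSchurComplex (toComplex A + L * toComplex C)) :
    ComplexStabilizes A B C (toComplex A + toComplex B * F + L * toComplex C) (-L) F := by
  intro lam hlam z s hz hs
  simp only [add_mulVec, neg_mulVec, ← mulVec_mulVec] at hs
  -- The observer error `s - z` evolves under `A + L C` alone.
  have he : s - z = 0 := by
    refine hL lam hlam _ ?_
    simp only [add_mulVec, ← mulVec_mulVec, mulVec_sub, smul_sub, ← hz, ← hs]
    abel
  obtain rfl : s = z := sub_eq_zero.1 he
  have hs0 : s = 0 := by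
    refine hF lam hlam s ?_
    rwa [add_mulVec, ← mulVec_mulVec]
  exact ⟨hs0, hs0⟩

/-- The plant is real and `1 ≤ ‖lam‖` is invariant under conjugation, so the closed-loop eigenvector
equations can be conjugated. -/
theorem ComplexStabilizes.conj {A : Matrix X X ℝ} {B : Matrix X U ℝ} {C : Matrix Y X ℝ}
    {Ar Ai : Matrix S S ℝ} {Br Bi : Matrix S Y ℝ} {Cr Ci : Matrix U S ℝ}
    (h : ComplexStabilizes A B C (toComplex Ar + Complex.I • toComplex Ai)
      (toComplex Br + Complex.I • toComplex Bi) (toComplex Cr + Complex.I • toComplex Ci)) :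
    ComplexStabilizes A B C (toComplex Ar - Complex.I • toComplex Ai)
      (toComplex Br - Complex.I • toComplex Bi) (toComplex Cr - Complex.I • toComplex Ci) := by
  intro lam hlam z s hz hs
  have key := h (star lam) (by simpa using hlam) (star z) (star s)
  rw [star_eq_zero, star_eq_zero] at key
  apply key
  · rw [← star_smul, ← hz]
    simp only [star_add, star_sub, star_smul, star_toComplex_mulVec, add_mulVec, sub_mulVec,
      smul_mulVec, Complex.star_def, Complex.conj_I, neg_smul, sub_neg_eq_add]
  · rw [← star_smul, ← hs]
    simp only [star_add, star_sub, star_smul, star_toComplex_mulVec, add_mulVec, sub_mulVec,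
      smul_mulVec, Complex.star_def, Complex.conj_I, neg_smul, sub_neg_eq_add]

/-- The real controller which runs the complex controller `(Ar + i Ai, Br + i Bi, Cr + i Ci)` in
closed loop with the plant and a simulated copy of the plant playing the role of its
imaginary part. -/
def realification (P : GeneralizedPlant X W U Z Y) (Ar Ai : Matrix S S ℝ) (Br Bi : Matrix S Y ℝ)
    (Cr Ci : Matrix U S ℝ) : Controller (X ⊕ (S ⊕ S)) Y U where
  A := fromBlocks P.A (fromCols (P.B * Ci) (P.B * Cr)) (fromRows (-(Bi * P.C)) (Br * P.C))
    (fromBlocks Ar (-Ai) Ai Ar)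
  B := fromRows 0 (fromRows Br Bi)
  C := fromCols 0 (fromCols Cr (-Ci))
  D := 0

theorem ComplexStabilizes.stabilizes_realification [DecidableEq X] [DecidableEq S]
    {P : GeneralizedPlant X W U Z Y}
    {Ar Ai : Matrix S S ℝ} {Br Bi : Matrix S Y ℝ} {Cr Ci : Matrix U S ℝ}
    (h : ComplexStabilizes P.A P.B P.C (toComplex Ar + Complex.I • toComplex Ai)
      (toComplex Br + Complex.I • toComplex Bi) (toComplex Cr + Complex.I • toComplex Ci)) :
    Stabilizes (realification P Ar Ai Br Bi Cr Ci) P := by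
  rw [Stabilizes, isSchur_iff]
  intro lam hlam v hv
  obtain ⟨x, v, rfl⟩ : ∃ a b, v = Sum.elim a b := ⟨_, _, (Sum.elim_comp_inl_inr v).symm⟩
  obtain ⟨w, v, rfl⟩ : ∃ a b, v = Sum.elim a b := ⟨_, _, (Sum.elim_comp_inl_inr v).symm⟩
  obtain ⟨p, q, rfl⟩ : ∃ a b, v = Sum.elim a b := ⟨_, _, (Sum.elim_comp_inl_inr v).symm⟩
  simp only [closedLoopMatrix, realification, toComplex_fromBlocks, toComplex_fromCols,
    toComplex_fromRows, fromBlocks_mulVec, fromRows_mulVec, fromCols_mulVec, toComplex_mul,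
    toComplex_neg, toComplex_zero, Sum.elim_comp_inl, Sum.elim_comp_inr,
    smul_sumElim, add_sumElim, sumElim_eq_iff, Matrix.mul_zero, Matrix.zero_mul, add_zero,
    zero_mulVec, zero_add, neg_mulVec, ← mulVec_mulVec, mulVec_add, mulVec_neg] at hv
  obtain ⟨hx, hw, hp, hq⟩ := hv
  have hI := Complex.I_mul_I
  -- `x + i w` and `p + i q` satisfy the eigenvector equations of the plant in loop with the complex
  -- controller.
  obtain ⟨hz, hs⟩ := h lam hlam (x + Complex.I • w) (p + Complex.I • q)
    (by
      rw [smul_add, smul_comm lam, ← hx, ← hw]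
      simp only [mulVec_add, mulVec_smul, add_mulVec, smul_mulVec, smul_add, smul_smul, hI]
      module)
    (by
      rw [smul_add, smul_comm lam, ← hp, ← hq]
      simp only [mulVec_add, mulVec_smul, add_mulVec, smul_mulVec, smul_add, smul_smul, hI]
      module)
  -- The components are themselves complex, so `x + i w = 0` does not yet give `x = w = 0`; the
  -- conjugate controller handles `x - i w` and `p - i q`.
  obtain ⟨hz', hs'⟩ := h.conj lam hlam (x - Complex.I • w) (p - Complex.I • q)
    (by
      rw [smul_sub, smul_comm lam, ← hx, ← hw]
      simp only [mulVec_sub, mulVec_smul, sub_mulVec, smul_mulVec, smul_sub, smul_add, smul_smul,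
        hI]
      module)
    (by
      rw [smul_sub, smul_comm lam, ← hp, ← hq]
      simp only [mulVec_sub, mulVec_smul, sub_mulVec, smul_mulVec, smul_sub, smul_add, smul_smul,
        hI]
      module)
  obtain ⟨rfl, rfl⟩ := eq_zero_of_add_sub_I_smul hz hz'
  obtain ⟨rfl, rfl⟩ := eq_zero_of_add_sub_I_smul hs hs'
  simp

/-- Renaming the states of a controller. -/
def Controller.reindex {T : Type*} (K : Controller S Y U) (e : S ≃ T) : Controller T Y U where
  A := K.A.submatrix e.symm e.symm
  B := K.B.submatrix e.symm id
  C := K.C.submatrix id e.symm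
  D := K.D

theorem Stabilizes.reindex {T : Type*} [Fintype T] [DecidableEq X] [DecidableEq S] [DecidableEq T]
    {P : GeneralizedPlant X W U Z Y} {K : Controller S Y U} (h : Stabilizes K P) (e : S ≃ T) :
    Stabilizes (K.reindex e) P := by
  have key : toComplex (closedLoopMatrix P (K.reindex e)) =
      Matrix.reindex ((Equiv.refl X).sumCongr e) ((Equiv.refl X).sumCongr e)
        (toComplex (closedLoopMatrix P K)) := by
    ext (i | i) (j | j) <;> rfl
  rw [Stabilizes, isSchur_iff, isSchurComplex_iff_charpoly] at h ⊢
  rwa [key, charpoly_reindex]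

/-- A plant without feedthrough from the control input to the measurement can be stabilized by
dynamic output feedback iff it passes the Hautus tests. -/
theorem exists_stabilizes_iff [DecidableEq X] (P : GeneralizedPlant X W U Z Y) :
    (∃ (nc : ℕ) (K : Controller (Fin nc) Y U), Stabilizes K P) ↔
      IsHautusStabilizable (toComplex P.A) (toComplex P.B) ∧
        IsHautusDetectable (toComplex P.A) (toComplex P.C) := by
  constructor
  · rintro ⟨nc, K, hK⟩
    rw [Stabilizes, isSchur_iff] at hK
    constructor
    · intro lam hlam x hx hB
      have := hK.left_eigenvector_eq_zero hlam (x := Sum.elim x 0) (by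
        simp only [closedLoopMatrix, toComplex_fromBlocks, vecMul_fromBlocks, toComplex_add,
          toComplex_mul, vecMul_add, ← vecMul_vecMul, hx, hB, smul_sumElim, Sum.elim_comp_inl,
          Sum.elim_comp_inr, zero_vecMul, add_zero, smul_zero])
      exact ((sumElim_eq_iff x 0 0 0).1 (this.trans (by simp))).1
    · intro lam hlam x hx hC
      have := hK lam hlam (Sum.elim x 0) (by
        simp only [closedLoopMatrix, toComplex_fromBlocks, fromBlocks_mulVec, toComplex_add,
          toComplex_mul, add_mulVec, ← mulVec_mulVec, hx, hC, smul_sumElim, Sum.elim_comp_inl,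
          Sum.elim_comp_inr, mulVec_zero, add_zero, smul_zero])
      exact ((sumElim_eq_iff x 0 0 0).1 (this.trans (by simp))).1
  · rintro ⟨hs, hd⟩
    obtain ⟨F, hF⟩ := hs.exists_feedback
    obtain ⟨L, hL⟩ := hd.exists_injection
    have h := complexStabilizes_observer hF hL
    rw [← toComplex_re_add_im (toComplex P.A + toComplex P.B * F + L * toComplex P.C),
      ← toComplex_re_add_im (-L), ← toComplex_re_add_im F] at h
    exact ⟨_, _, h.stabilizes_realification.reindex (Fintype.equivFin _)⟩

end Controllers

/-! ### The Hautus tests for the transformed plant -/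

section Transformed

variable {n nu d nv : ℕ} (G : System n nu d nv) {m L ρ : ℝ}

/-- Left and right eigenvalues are the roots of the same characteristic polynomial, so the
eigenvalue clause is redundant. -/
theorem not_isUncontrollableMode_iff {ι κ : Type*} [Fintype ι] [DecidableEq ι]
    {A : Matrix ι ι ℝ} {B : Matrix ι κ ℝ} {lam : ℂ} :
    ¬ IsUncontrollableMode A B lam ↔ ∀ x : ι → ℂ,
      x ᵥ* toComplex A = lam • x → x ᵥ* toComplex B = 0 → x = 0 := by
  rw [IsUncontrollableMode, hasEigenvalue_toLin'_iff, exists_right_eigenvector_iff,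
    ← exists_left_eigenvector_iff]
  constructor
  · intro h x hA hB
    by_contra h0
    exact h ⟨⟨x, h0, hA⟩, x, h0, hA, hB⟩
  · rintro h ⟨-, x, h0, hA, hB⟩
    exact h0 (h x hA hB)

theorem not_isUnobservableMode_iff {ι κ : Type*} [Fintype ι] [DecidableEq ι]
    {A : Matrix ι ι ℝ} {C : Matrix κ ι ℝ} {lam : ℂ} :
    ¬ IsUnobservableMode A C lam ↔ ∀ x : ι → ℂ,
      toComplex A *ᵥ x = lam • x → toComplex C *ᵥ x = 0 → x = 0 := by
  rw [IsUnobservableMode, hasEigenvalue_toLin'_iff]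
  constructor
  · intro h x hA hC
    by_contra h0
    exact h ⟨⟨x, h0, hA⟩, x, h0, hA, hC⟩
  · rintro h ⟨-, x, h0, hA, hC⟩
    exact h0 (h x hA hC)

/-- Rescaling the Hautus test. -/
theorem isHautusStabilizable_inv_smul {ι κ : Type*} [Fintype ι] (hρ : 0 < ρ)
    {A : Matrix ι ι ℂ} {B : Matrix ι κ ℂ} :
    IsHautusStabilizable ((ρ⁻¹ : ℂ) • A) ((ρ⁻¹ : ℂ) • B) ↔
      ∀ lam : ℂ, ρ ≤ ‖lam‖ → ∀ x : ι → ℂ, x ᵥ* A = lam • x → x ᵥ* B = 0 → x = 0 := by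
  have hρ' : (ρ : ℂ) ≠ 0 := Complex.ofReal_ne_zero.2 hρ.ne'
  constructor
  · intro h lam hlam x hA hB
    refine h ((ρ : ℂ)⁻¹ * lam) ?_ x ?_ ?_
    · rw [norm_mul, norm_inv, Complex.norm_of_nonneg hρ.le, inv_mul_eq_div, one_le_div hρ]
      exact hlam
    · rw [vecMul_smul, hA, smul_smul]
    · rw [vecMul_smul, hB, smul_zero]
  · intro h lam hlam x hA hB
    rw [vecMul_smul, inv_smul_eq_iff₀ hρ'] at hA hB
    refine h (ρ * lam) ?_ x ?_ ?_
    · rw [norm_mul, Complex.norm_of_nonneg hρ.le]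
      exact le_mul_of_one_le_right hρ.le hlam
    · rw [hA, smul_smul]
    · rw [hB, smul_zero]

theorem isHautusDetectable_inv_smul {ι κ : Type*} [Fintype ι] (hρ : 0 < ρ)
    {A : Matrix ι ι ℂ} {C : Matrix κ ι ℂ} :
    IsHautusDetectable ((ρ⁻¹ : ℂ) • A) C ↔
      ∀ lam : ℂ, ρ ≤ ‖lam‖ → ∀ x : ι → ℂ, A *ᵥ x = lam • x → C *ᵥ x = 0 → x = 0 := by
  have hρ' : (ρ : ℂ) ≠ 0 := Complex.ofReal_ne_zero.2 hρ.ne'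
  constructor
  · intro h lam hlam x hA hC
    refine h ((ρ : ℂ)⁻¹ * lam) ?_ x ?_ hC
    · rw [norm_mul, norm_inv, Complex.norm_of_nonneg hρ.le, inv_mul_eq_div, one_le_div hρ]
      exact hlam
    · rw [smul_mulVec, hA, smul_smul]
  · intro h lam hlam x hA hC
    rw [smul_mulVec, inv_smul_eq_iff₀ hρ'] at hA
    refine h (ρ * lam) ?_ x ?_ hC
    · rw [norm_mul, Complex.norm_of_nonneg hρ.le]
      exact le_mul_of_one_le_right hρ.le hlam
    · rw [hA, smul_smul]

theorem toComplex_transformedPlant_A : toComplex (transformedPlant G m L ρ).A =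
    (ρ⁻¹ : ℂ) • fromBlocks 1 ((m : ℂ) • toComplex G.C₁) 0 (toComplex G.A) := by
  have : (transformedPlant G m L ρ).A = ρ⁻¹ • fromBlocks 1 (m • G.C₁) 0 G.A := by
    simp only [transformedPlant, extremumPlant, fromRows_mul, mul_fromCols, Matrix.one_mul,
      Matrix.zero_mul]
    congr 1
    ext (i | i) (j | j) <;> simp
  rw [this, toComplex_smul, toComplex_fromBlocks, toComplex_one, toComplex_zero, toComplex_smul,
    Complex.ofReal_inv]

theorem toComplex_transformedPlant_B : toComplex (transformedPlant G m L ρ).B =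
    (ρ⁻¹ : ℂ) • fromRows ((m : ℂ) • toComplex G.D₁) (toComplex G.B) := by
  have : (transformedPlant G m L ρ).B = ρ⁻¹ • fromRows (m • G.D₁) G.B := by
    simp only [transformedPlant, extremumPlant, fromRows_mul, Matrix.one_mul, Matrix.zero_mul]
    congr 1
    ext (i | i) j <;> simp
  rw [this, toComplex_smul, toComplex_fromRows, toComplex_smul, Complex.ofReal_inv]

theorem toComplex_transformedPlant_C : toComplex (transformedPlant G m L ρ).C =
    fromBlocks 1 0 0 (toComplex G.C₂) := by
  rw [transformedPlant, extremumPlant, toComplex_fromBlocks, toComplex_one, toComplex_zero,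
    toComplex_zero]

theorem forall_sumElim {ι κ : Type*} {p : (ι ⊕ κ → ℂ) → Prop} :
    (∀ x, p x) ↔ ∀ a b, p (Sum.elim a b) :=
  ⟨fun h _ _ => h _, fun h x => Sum.elim_comp_inl_inr x ▸ h _ _⟩

theorem sumElim_eq_zero_iff {ι κ : Type*} {a : ι → ℂ} {b : κ → ℂ} :
    Sum.elim a b = 0 ↔ a = 0 ∧ b = 0 := by
  rw [← sumElim_eq_iff, Sum.elim_zero_zero]

/-- Measuring the integrator state forces its component to vanish; its eigenvector equation then
reads `m C₁ b = 0`, so `C₁ b = 0` although only `C₂` is measured directly. -/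
theorem isHautusDetectable_transformedPlant_iff (hm : 0 < m) (hρ : 0 < ρ) :
    IsHautusDetectable (toComplex (transformedPlant G m L ρ).A)
        (toComplex (transformedPlant G m L ρ).C) ↔
      (∀ lam : ℂ, ρ ≤ ‖lam‖ → ¬ IsUnobservableMode G.A G.C lam) := by
  rw [toComplex_transformedPlant_A, toComplex_transformedPlant_C, isHautusDetectable_inv_smul hρ]
  refine forall₂_congr fun lam _ => ?_
  rw [not_isUnobservableMode_iff, forall_sumElim, System.C, toComplex_fromRows]
  simp only [fromBlocks_mulVec, fromRows_mulVec, Sum.elim_comp_inl, Sum.elim_comp_inr,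
    smul_sumElim, sumElim_eq_iff, sumElim_eq_zero_iff, one_mulVec, zero_mulVec, add_zero, zero_add,
    smul_mulVec]
  have hm' : (m : ℂ) ≠ 0 := Complex.ofReal_ne_zero.2 hm.ne'
  constructor
  · rintro h x hA ⟨hC₁, hC₂⟩
    exact (h 0 x ⟨by simp [hC₁], hA⟩ ⟨rfl, hC₂⟩).2
  · rintro h a b ⟨hC₁, hA⟩ ⟨rfl, hC₂⟩
    rw [zero_add, smul_zero, smul_eq_zero_iff_right hm'] at hC₁
    exact ⟨rfl, h b hA ⟨hC₁, hC₂⟩⟩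

theorem isHautusStabilizable_transformedPlant_iff (hm : 0 < m) (hρ : 0 < ρ) (hρ₁ : ρ < 1) :
    IsHautusStabilizable (toComplex (transformedPlant G m L ρ).A)
        (toComplex (transformedPlant G m L ρ).B) ↔
      (∀ lam : ℂ, ρ ≤ ‖lam‖ → ¬ IsUncontrollableMode G.A G.B lam) ∧
        HasFullRowRank (Matrix.fromBlocks (G.A - 1) G.B G.C₁ G.D₁) := by
  rw [toComplex_transformedPlant_A, toComplex_transformedPlant_B, isHautusStabilizable_inv_smul hρ]
  have hm' : (m : ℂ) ≠ 0 := Complex.ofReal_ne_zero.2 hm.ne'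
  simp only [not_isUncontrollableMode_iff, forall_sumElim, hasFullRowRank_iff,
    toComplex_fromBlocks, toComplex_sub, toComplex_one, vecMul_fromBlocks, vecMul_fromRows,
    Sum.elim_comp_inl, Sum.elim_comp_inr,
    smul_sumElim, sumElim_eq_iff, sumElim_eq_zero_iff, vecMul_one, vecMul_zero, add_zero,
    vecMul_sub, vecMul_smul]
  constructor
  · intro h
    refine ⟨fun lam hlam x hA hB => (h lam hlam 0 x ?_ ?_).2, fun a b ⟨hA, hB⟩ => ?_⟩
    · simp [hA]
    · simp [hB]
    -- A left kernel vector `(a, b)` gives the left eigenvector `(m⁻¹ b, a)` at `lam = 1`; `m⁻¹`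
    -- cancels the factor on `C₁` and `D₁`.
    · have key := h 1 (by simpa using hρ₁.le) ((m : ℂ)⁻¹ • b) a
      simp only [one_smul, true_and, smul_vecMul, smul_inv_smul₀ hm', smul_eq_zero_iff_right
        (inv_ne_zero hm')] at key
      exact (key (by rw [← sub_eq_zero, ← hA]; abel) (by rw [← hB, add_comm])).symm
  · rintro ⟨h, hrank⟩ lam hlam a b ⟨ha, hA⟩ hB
    by_cases hlam1 : lam = 1
    · subst hlam1
      have key := hrank b ((m : ℂ) • a)
      simp only [smul_vecMul, smul_eq_zero_iff_right hm'] at key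
      refine (key ⟨?_, by rw [← hB, add_comm]⟩).symm
      rw [one_smul, ← sub_eq_zero] at hA
      rw [← hA]
      abel
    · have ha0 : a = 0 := by
        have : (1 - lam) • a = 0 := by rw [sub_smul, one_smul, ← ha, sub_self]
        exact (smul_eq_zero_iff_right (sub_ne_zero.2 (Ne.symm hlam1))).1 this
      subst ha0
      rw [zero_vecMul, smul_zero, zero_add] at hA hB
      exact ⟨rfl, h lam hlam b hA hB⟩

end Transformed
end ExtremumControl

theorem mainTheorem12 {n nu d nv : ℕ} (G : ExtremumControl.System n nu d nv)
    (m L ρ : ℝ) (hm : 0 < m) (hL : m < L) (hρ₀ : 0 < ρ) (hρ₁ : ρ < 1) :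
    (∃ (nc : ℕ) (K : ExtremumControl.Controller (Fin nc) (Fin d ⊕ Fin nv) (Fin nu)),
      ExtremumControl.Stabilizes K (ExtremumControl.transformedPlant G m L ρ)) ↔
    (∀ lam : ℂ, ρ ≤ ‖lam‖ → ¬ ExtremumControl.IsUncontrollableMode G.A G.B lam) ∧
    (∀ lam : ℂ, ρ ≤ ‖lam‖ → ¬ ExtremumControl.IsUnobservableMode G.A G.C lam) ∧
    ExtremumControl.HasFullRowRank (Matrix.fromBlocks (G.A - 1) G.B G.C₁ G.D₁) := by
  rw [ExtremumControl.exists_stabilizes_iff,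
    ExtremumControl.isHautusStabilizable_transformedPlant_iff G hm hρ₀ hρ₁,
    ExtremumControl.isHautusDetectable_transformedPlant_iff G hm hρ₀]
  tauto
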